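/- A pushdown system (PDS) over a finite set $AP$ of atomic propositions and a finite stack alphabet $\Theta$ is a tuple $\mathcal{PD}=(S,S_0,R,L_{\mathcal{PD}})$ with a finite set $S$ of control locations, initial locations $S_0\subseteq S$, a labelling $L_{\mathcal{PD}}\colon S\to 2^{AP}$ and a transition relation $R\subseteq (S\times S)\,\dot\cup\,(S\times S\times\Theta)\,\dot\cup\,(S\times\Theta\times S)$ of internal, push and pop transitions. A path is an infinite sequence $c_0m_0c_1m_1\dots$ of configurations $c_i\in S\times\Theta^*\bot$ and transition symbols $m_i\in\{\mathit{int},\mathit{call},\mathit{ret}\}$ such that $c_0=(s_0,\bot)$ with $s_0\in S_0$ and, for each $i$, $c_{i+1}$ arises from $c_i$ by an internal, push or pop transition of $R$ according to $m_i$ (the bottom symbol $\bot\notin\Theta$ is never pushed or popped). $\mathit{Traces}(\mathcal{PD})$ is the set of sequences $L_{\mathcal{PD}}(s_0)m_0L_{\mathcal{PD}}(s_1)m_1\dots$ induced by the paths, where $s_i$ is the control location of $c_i$. For sets $L,H\subseteq AP$ of low-security and high-security variables, generalised non-interference is the HyperLTL formula $$\varphi_{\mathit{GNI}}^{L,H}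 := \forall \pi_1.\,\forall \pi_2.\,\exists \pi_3.\ \Big(\mathcal{G}\bigwedge_{a\in L} (a_{\pi_1}\leftrightarrow a_{\pi_3})\Big)\wedge\Big(\mathcal{G}\bigwedge_{a\in H} (a_{\pi_2}\leftrightarrow a_{\pi_3})\Big),$$ and $\mathcal{PD}\models\varphi_{\mathit{GNI}}^{L,H}$ means that it holds when the trace quantifiers range over $\mathit{Traces}(\mathcal{PD})$. **Theorem.** Checking generalised non-interference is undecidable for pushdown systems: there is no algorithm that, given a finite set $AP$, sets $L,H\subseteq AP$ and a PDS $\mathcal{PD}$ over $AP$, decides whether $\mathcal{PD}\models\varphi_{\mathit{GNI}}^{L,H}$. The problem is undecidable already for a fixed formula: there are a finite set $AP$ and a partition $AP=L\,\dot\cup\,H$ such that no algorithm decides, given a PDS $\mathcal{PD}$ over $AP$, whether $\mathcal{PD}\models\varphi_{\mathit{GNI}}^{L,H}$. -/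

import Mathlib

namespace HyperPDS

/-! ### Pushdown systems and their traces -/

/-- The three kinds of transition symbols on paths and traces. -/
inductive Move : Type
  | int : Move
  | call : Move
  | ret : Move

/-- Transitions `(s, s')` (internal), `(s, s', θ)` (push `θ`) and `(s, θ, s')` (pop `θ`). -/
abbrev Trans (S Θ : Type) : Type := (S × S) ⊕ ((S × S × Θ) ⊕ (S × Θ × S))

/-- A pushdown system with control locations `S`, stack symbols `Θ` and atomic propositions `AP`.
In all decision problems below these three types are finite. -/
structure PDS (AP S Θ : Type) where
  init : Set S
  trans : Set (Trans S Θ)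
  label : S → Set AP

/-- A configuration `(s, u⊥)`. The stack content `u⊥` is represented by the list `u` (top first);
the bottom symbol `⊥` is never pushed or popped. -/
abbrev Config (S Θ : Type) : Type := S × List Θ

/-- `P.Step c m c'` : the configuration `c'` is an `m`-successor of `c`. -/
def PDS.Step {AP S Θ : Type} (P : PDS AP S Θ) (c : Config S Θ) (m : Move) (c' : Config S Θ) :
    Prop :=
  match m with
  | Move.int => Sum.inl (c.1, c'.1) ∈ P.trans ∧ c'.2 = c.2
  | Move.call => ∃ θ : Θ, Sum.inr (Sum.inl (c.1, c'.1, θ)) ∈ P.trans ∧ c'.2 = θ :: c.2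
  | Move.ret => ∃ θ : Θ, Sum.inr (Sum.inr (c.1, θ, c'.1)) ∈ P.trans ∧ c.2 = θ :: c'.2

/-- The infinite alternating sequence `c 0, m 0, c 1, m 1, …` is a path of `P`. -/
def PDS.IsPath {AP S Θ : Type} (P : PDS AP S Θ) (c : ℕ → Config S Θ) (m : ℕ → Move) : Prop :=
  (c 0).1 ∈ P.init ∧ (c 0).2 = [] ∧ ∀ i, P.Step (c i) (m i) (c (i + 1))

/-- Infinite traces `P₀ m₀ P₁ m₁ …`; position `i` carries the pair `(Pᵢ, mᵢ)`. -/
abbrev Trace (AP : Type) : Type := ℕ → Set AP × Move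

/-- The set of traces induced by the paths of `P`. -/
def PDS.traces {AP S Θ : Type} (P : PDS AP S Θ) : Set (Trace AP) :=
  {t | ∃ (c : ℕ → Config S Θ) (m : ℕ → Move), P.IsPath c m ∧
    t = fun i => (P.label (c i).1, m i)}

/-! ### HyperLTL -/

/-- Quantifier-free HyperLTL formulae over `n` trace variables. -/
inductive Body (AP : Type) (n : ℕ) : Type
  | atom : AP → Fin n → Body AP n
  | tt : Body AP n
  | neg : Body AP n → Body AP n
  | and : Body AP n → Body AP n → Body AP n
  | next : Body AP n → Body AP n
  | untl : Body AP n → Body AP n → Body AP n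

/-- HyperLTL formulae in prenex form with the `n` free trace variables `0, …, n - 1`; a quantifier
in front of a formula with `n + 1` free trace variables binds the variable `n`. -/
inductive Formula (AP : Type) : ℕ → Type
  | all {n : ℕ} : Formula AP (n + 1) → Formula AP n
  | ex {n : ℕ} : Formula AP (n + 1) → Formula AP n
  | body {n : ℕ} : Body AP n → Formula AP n

/-- Satisfaction of a quantifier-free formula at position `i` of the traces assigned by `ρ`. -/
def Body.Sat {AP : Type} {n : ℕ} (ρ : Fin n → Trace AP) : Body AP n → ℕ → Prop
  | .atom a π, i => a ∈ (ρ π i).1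
  | .tt, _ => True
  | .neg φ, i => ¬ φ.Sat ρ i
  | .and φ ψ, i => φ.Sat ρ i ∧ ψ.Sat ρ i
  | .next φ, i => φ.Sat ρ (i + 1)
  | .untl φ ψ, i => ∃ j, i ≤ j ∧ ψ.Sat ρ j ∧ ∀ k, i ≤ k → k < j → φ.Sat ρ k

/-- Satisfaction of a formula by an assignment of traces, where quantifiers range over `T`. -/
def Formula.Sat {AP : Type} (T : Set (Trace AP)) :
    {n : ℕ} → Formula AP n → (Fin n → Trace AP) → Prop
  | n, .all φ, ρ => ∀ t ∈ T, φ.Sat T (Fin.snoc (α := fun _ : Fin (n + 1) => Trace AP) ρ t)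
  | n, .ex φ, ρ => ∃ t ∈ T, φ.Sat T (Fin.snoc (α := fun _ : Fin (n + 1) => Trace AP) ρ t)
  | _, .body ψ, ρ => ψ.Sat ρ 0

/-- `P ⊨ φ` for a closed HyperLTL formula `φ`. -/
def PDS.Models {AP S Θ : Type} (P : PDS AP S Θ) (φ : Formula AP 0) : Prop :=
  φ.Sat P.traces Fin.elim0

/-- `φ → ψ`. -/
def Body.imp {AP : Type} {n : ℕ} (φ ψ : Body AP n) : Body AP n := .neg (.and φ (.neg ψ))

/-- `φ ↔ ψ`. -/
def Body.iff {AP : Type} {n : ℕ} (φ ψ : Body AP n) : Body AP n := .and (φ.imp ψ) (ψ.imp φ)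

/-- `𝓖 φ`, that is `¬ (true 𝓤 ¬ φ)`. -/
def Body.globally {AP : Type} {n : ℕ} (φ : Body AP n) : Body AP n := .neg (.untl .tt (.neg φ))

/-- `⋀_{a ∈ A} f a`. -/
noncomputable def Body.bigAnd {AP : Type} {n : ℕ} (A : Finset AP) (f : AP → Body AP n) :
    Body AP n :=
  (A.toList.map f).foldr Body.and Body.tt

/-- Generalised non-interference for low-security variables `L` and high-security variables `H`:
`∀ π₁. ∀ π₂. ∃ π₃. (𝓖 ⋀_{a ∈ L} a_π₁ ↔ a_π₃) ∧ (𝓖 ⋀_{a ∈ H} a_π₂ ↔ a_π₃)`. The trace variables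
`π₁, π₂, π₃` are `0, 1, 2`. -/
noncomputable def gni {AP : Type} (L H : Finset AP) : Formula AP 0 :=
  .all (.all (.ex (.body (.and
    (Body.bigAnd L fun a => (Body.atom a (0 : Fin 3)).iff (.atom a (2 : Fin 3))).globally
    (Body.bigAnd H fun a => (Body.atom a (1 : Fin 3)).iff (.atom a (2 : Fin 3))).globally))))

/-! ### Inputs of the decision problem -/

/-- A finite description of a pushdown system: the number of control locations, the number of
stack symbols, and lists of the initial locations, of the transitions and of the pairs `(s, a)`
such that the location `s` is labelled with the proposition `a`. -/
structure Code where
  numStates : ℕ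
  numStack : ℕ
  init : List ℕ
  trans : List (Trans ℕ ℕ)
  label : List (ℕ × ℕ)

/-- Codes are tuples. -/
def Code.equiv : Code ≃ ℕ × ℕ × List ℕ × List (Trans ℕ ℕ) × List (ℕ × ℕ) where
  toFun c := (c.numStates, c.numStack, c.init, c.trans, c.label)
  invFun t := ⟨t.1, t.2.1, t.2.2.1, t.2.2.2.1, t.2.2.2.2⟩
  left_inv _ := rfl
  right_inv _ := rfl

instance Code.primcodable : Primcodable Code := Primcodable.ofEquiv _ Code.equiv

/-- The transition between natural numbers that stands for a transition between elements of
`Fin s` and `Fin t`. -/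
def natTrans {s t : ℕ} : Trans (Fin s) (Fin t) → Trans ℕ ℕ
  | .inl (p, q) => .inl (p, q)
  | .inr (.inl (p, q, θ)) => .inr (.inl (p, q, θ))
  | .inr (.inr (p, θ, q)) => .inr (.inr (p, θ, q))

/-- The pushdown system over `k` atomic propositions described by a code. List entries with a
component out of range describe nothing, so every code describes a pushdown system; conversely,
every pushdown system over the types `Fin k`, `Fin s`, `Fin t` is described by a code. -/
def Code.toPDS (c : Code) (k : ℕ) : PDS (Fin k) (Fin c.numStates) (Fin c.numStack) where
  init := {q | (q : ℕ) ∈ c.init}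
  trans := {r | natTrans r ∈ c.trans}
  label q := {a | ((q : ℕ), (a : ℕ)) ∈ c.label}

/-- The subset of `Fin k` described by a list. -/
def listSet (k : ℕ) (l : List ℕ) : Finset (Fin k) := {a | (a : ℕ) ∈ l}

/-- An instance of the problem of checking generalised non-interference: a number `k` of atomic
propositions, a pushdown system over them, and the lists of low and of high variables. -/
abbrev Instance : Type := ℕ × Code × List ℕ × List ℕ

/-- The pushdown system of the instance satisfies generalised non-interference. -/
def HasGNI : Instance → Prop
  | (k, c, l, h) => (c.toPDS k).Models (gni (listSet k l) (listSet k h))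

end HyperPDS

namespace HyperPDS

/-! ### Generalised non-interference of a set of traces -/

/-! The reduction is from the halting problem of one universal machine with several stacks; it rests
on the fact that an error in a run of such a machine can be found with a single stack. A run is
written as a word whose letters record an instruction, an internal state and the symbol claimed to
be read. A word fails to describe a halting run if it starts wrongly, if two consecutive letters do
not fit, if a claimed symbol is not the top of the stack being read, or if no halting letter occurs.
A pushdown system that guesses the kind of failure has to simulate at most one of the stacks.

The error checker spells words in its low variables and has one high variable. If that variable is
true, the word is arbitrary; if it is false, the word must fail in one of these ways. Generalised
non-interference lets every low word be combined with either value of the high variable, so it says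
that every word fails, that is, that the machine does not halt (`StackSystem.gniOn_checker_iff`).
The formula compares propositions only, so the three traces may use their stacks quite differently.

The input of the machine is pushed by a forced initial phase, which does not affect the property
(`models_loadCode`). Only this phase depends on the input, so the propositions and the formula stay
fixed. `StackMachine.accepts_iff` identifies halting with the existence of an error-free word, and
`exists_code_halting` supplies the machine. -/

/-- Generalised non-interference of a set of traces. -/
def GNIOn {AP : Type} (L H : Set AP) (T : Set (Trace AP)) : Prop :=
  ∀ t₁ ∈ T, ∀ t₂ ∈ T, ∃ t₃ ∈ T, (∀ i, ∀ a ∈ L, a ∈ (t₁ i).1 ↔ a ∈ (t₃ i).1) ∧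
    ∀ i, ∀ a ∈ H, a ∈ (t₂ i).1 ↔ a ∈ (t₃ i).1

theorem Body.sat_iff {AP : Type} {n : ℕ} (ρ : Fin n → Trace AP) (φ ψ : Body AP n) (i : ℕ) :
    (φ.iff ψ).Sat ρ i ↔ (φ.Sat ρ i ↔ ψ.Sat ρ i) := by
  simp only [Body.iff, Body.imp, Body.Sat]
  tauto

theorem Body.sat_globally {AP : Type} {n : ℕ} (ρ : Fin n → Trace AP) (φ : Body AP n) :
    φ.globally.Sat ρ 0 ↔ ∀ i, φ.Sat ρ i := by
  simp [Body.globally, Body.Sat]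

theorem Body.sat_bigAnd {AP : Type} {n : ℕ} (ρ : Fin n → Trace AP) (A : Finset AP)
    (f : AP → Body AP n) (i : ℕ) : (Body.bigAnd A f).Sat ρ i ↔ ∀ a ∈ A, (f a).Sat ρ i := by
  have key : ∀ l : List AP, ((l.map f).foldr Body.and Body.tt).Sat ρ i ↔
      ∀ a ∈ l, (f a).Sat ρ i := by
    intro l
    induction l with
    | nil => simp [Body.Sat]
    | cons b l ih => simp [Body.Sat, ih]
  simpa [Body.bigAnd] using key A.toList

theorem PDS.models_gni {AP S Θ : Type} (P : PDS AP S Θ) (L H : Finset AP) :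
    P.Models (gni L H) ↔ GNIOn (L : Set AP) H P.traces := by
  simp only [PDS.Models, gni, Formula.Sat, Body.Sat, GNIOn, Body.sat_globally, Body.sat_bigAnd,
    Body.sat_iff]
  rfl

/-! ### Paths from a given configuration -/

/-- The traces of the paths of `P` that start in the configuration `x`. -/
def PDS.tracesFrom {AP S Θ : Type} (P : PDS AP S Θ) (x : Config S Θ) : Set (Trace AP) :=
  {t | ∃ (c : ℕ → Config S Θ) (m : ℕ → Move), c 0 = x ∧ (∀ i, P.Step (c i) (m i) (c (i + 1))) ∧
    t = fun i => (P.label (c i).1, m i)}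

/-- Dependent choice: an invariant that can always be carried one step further yields an infinite
path. Indexing it by time lets a path follow a prescribed word. -/
theorem PDS.exists_path_of_progress {AP S Θ : Type} (P : PDS AP S Θ)
    (I : ℕ → Config S Θ → Prop) (x : Config S Θ) (h0 : I 0 x)
    (hI : ∀ i y, I i y → ∃ m z, P.Step y m z ∧ I (i + 1) z) :
    ∃ (c : ℕ → Config S Θ) (m : ℕ → Move), c 0 = x ∧ (∀ i, P.Step (c i) (m i) (c (i + 1))) ∧
      ∀ i, I i (c i) := by
  have : Inhabited Move := ⟨.int⟩
  have : Nonempty (Config S Θ) := ⟨x⟩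
  choose! m z hs hz using hI
  let c : ℕ → Config S Θ := fun n => Nat.rec x (fun i y => z i y) n
  have hc : ∀ i, I i (c i) := by
    intro i
    induction i with
    | zero => exact h0
    | succ i ih => exact hz i _ ih
  exact ⟨c, fun i => m i (c i), rfl, fun i => hs i _ (hc i), hc⟩

/-! ### Systems with several stacks -/

/-- Stack operations; popping the empty stack has no effect. -/
inductive StackOp (Γ : Type) : Type
  | push : Γ → StackOp Γ
  | pop : StackOp Γ
  | nop : StackOp Γ

/-- The effect of a stack operation. -/
def StackOp.apply {Γ : Type} : StackOp Γ → List Γ → List Γ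
  | .push γ, l => γ :: l
  | .pop, l => l.tail
  | .nop, l => l

/-- A system with stacks `K` over the stack alphabet `Γ`. Its letters `A` stand for elementary
steps: a letter requires a property of the top of each stack, changes each stack and restricts the
next letter. -/
structure StackSystem (A K Γ : Type) where
  start : A → Prop
  next : A → A → Prop
  halting : A → Prop
  guard : A → K → Option Γ → Prop
  op : A → K → StackOp Γ

namespace StackSystem

variable {A K Γ : Type}

/-- The content of the stack `k` after the first `i` letters of the word `a`. -/
def stackAt (M : StackSystem A K Γ) (a : ℕ → A) (k : K) (l : List Γ) : ℕ → List Γ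
  | 0 => l
  | i + 1 => (M.op (a i) k).apply (M.stackAt a k l i)

/-- The system has a run from the given stacks to a halting letter. -/
def Accepts (M : StackSystem A K Γ) (st : K → List Γ) : Prop :=
  ∃ (a : ℕ → A) (N : ℕ), M.start (a 0) ∧ M.halting (a N) ∧
    ∀ i < N, ¬ M.halting (a i) ∧ M.next (a i) (a (i + 1)) ∧
      ∀ k, M.guard (a i) k (M.stackAt a k (st k) i).head?

/-- The content of a stack below its top, when each symbol carries what was the top below it. -/
def below : List Γ → List (Option Γ)
  | [] => []
  | _ :: l => l.head? :: below l

/-- A pushdown system cannot inspect its top without popping, nor test for emptiness. So the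
simulated top is kept in the control location and the real stack holds the successive tops beneath
it, ending with `none`. Popping the first symbol of the loaded word establishes this format. -/
theorem head?_cons_below (l : List Γ) : l.head? :: below l = l.map some ++ [none] := by
  induction l with
  | nil => rfl
  | cons a l ih => simp [below, ih]

/-- Control locations of the pushdown system that looks for an error in a run. -/
inductive Loc (A K Γ : Type) : Type
  | root : Loc A K Γ
  | high : A → Loc A K Γ
  | free : A → Loc A K Γ
  | ctl : A → Loc A K Γ
  | stk : K → A → Option Γ → Loc A K Γ

/-- Internal transitions of the error checker. -/
def intRel (M : StackSystem A K Γ) (k₀ : K) : Loc A K Γ → Loc A K Γ → Prop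
  | .root, .high _ => True
  | .root, .free b => ¬ M.start b
  | .root, .ctl b => M.start b
  | .root, .stk k _ o => k ≠ k₀ ∧ o = none
  | .high _, .high _ => True
  | .free _, .free _ => True
  | .ctl a, .ctl b => ¬ M.halting a ∧ M.next a b
  | .ctl a, .free b => ¬ M.halting a ∧ ¬ M.next a b
  | .stk k a o, .free _ => ¬ M.halting a ∧ ¬ M.guard a k o
  | .stk k a o, .stk k' _ o' => k' = k ∧ o' = o ∧ ¬ M.halting a ∧ M.guard a k o ∧
      (M.op a k = .nop ∨ M.op a k = .pop ∧ o = none)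
  | _, _ => False

/-- Push transitions of the error checker. -/
def pushRel (M : StackSystem A K Γ) : Loc A K Γ → Loc A K Γ → Option Γ → Prop
  | .stk k a o, .stk k' _ o', θ => k' = k ∧ θ = o ∧ ¬ M.halting a ∧ M.guard a k o ∧
      ∃ γ, M.op a k = .push γ ∧ o' = some γ
  | _, _, _ => False

/-- Pop transitions of the error checker. -/
def popRel (M : StackSystem A K Γ) (k₀ : K) : Loc A K Γ → Option Γ → Loc A K Γ → Prop
  | .root, θ, .stk k _ o => k = k₀ ∧ o = θ
  | .stk k a o, θ, .stk k' _ o' => k' = k ∧ o' = θ ∧ ¬ M.halting a ∧ M.guard a k o ∧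
      M.op a k = .pop ∧ o ≠ none
  | _, _, _ => False

/-- The labelling of the error checker: letters are low, and `none` is the high variable. -/
def locLabel : Loc A K Γ → Set (Option A)
  | .root => ∅
  | .high a => {some a, none}
  | .free a => {some a}
  | .ctl a => {some a}
  | .stk _ a _ => {some a}

/-- The pushdown system that looks for an error in a run of `M`. The low variables spell a word over
the letters of `M`. If the high variable stays false then the word has to contain an error in front
of its first halting letter; the high variable may be true for every word. -/
def checker (M : StackSystem A K Γ) (k₀ : K) : PDS (Option A) (Loc A K Γ) (Option Γ) where
  init := ∅
  trans := {t | match t with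
    | .inl (s, s') => M.intRel k₀ s s'
    | .inr (.inl (s, s', θ)) => M.pushRel s s' θ
    | .inr (.inr (s, θ, s')) => M.popRel k₀ s θ s'}
  label := locLabel

/-- The stacks of which only the stack `k₀` is non-empty. -/
noncomputable def single (k₀ : K) (w : List Γ) : K → List Γ := by
  classical exact Function.update (fun _ => []) k₀ w

/-- The configuration from which the error checker is started. -/
def rootConfig (w : List Γ) : Config (Loc A K Γ) (Option Γ) := (.root, w.map some ++ [none])

/-! ### Single steps of the error checker -/

@[simp] theorem step_int (M : StackSystem A K Γ) (k₀ : K) (x y : Config (Loc A K Γ) (Option Γ)) :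
    (M.checker k₀).Step x .int y ↔ M.intRel k₀ x.1 y.1 ∧ y.2 = x.2 := Iff.rfl

@[simp] theorem step_call (M : StackSystem A K Γ) (k₀ : K) (x y : Config (Loc A K Γ) (Option Γ)) :
    (M.checker k₀).Step x .call y ↔ ∃ θ, M.pushRel x.1 y.1 θ ∧ y.2 = θ :: x.2 := Iff.rfl

@[simp] theorem step_ret (M : StackSystem A K Γ) (k₀ : K) (x y : Config (Loc A K Γ) (Option Γ)) :
    (M.checker k₀).Step x .ret y ↔ ∃ θ, M.popRel k₀ x.1 θ y.1 ∧ x.2 = θ :: y.2 := Iff.rfl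

/-- The stack symbols that are never used by the checker of the stack `k`. -/
noncomputable def rest (k₀ : K) (w : List Γ) (k : K) : List (Option Γ) := by
  classical exact if k = k₀ then [] else w.map some ++ [none]

/-- The configuration of the checker of the stack `k` that reads the letter `a` with the stack
content `l`. -/
noncomputable def stkConfig (k₀ : K) (w : List Γ) (k : K) (a : A) (l : List Γ) :
    Config (Loc A K Γ) (Option Γ) := (.stk k a l.head?, below l ++ rest k₀ w k)

/-- A stack other than `k₀` starts empty, so the loaded word merely lies unused beneath the
simulation. -/
theorem stkConfig_of_ne {k₀ k : K} {w : List Γ} (h : k ≠ k₀) (a : A) :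
    (.stk k a none, w.map some ++ [none]) = stkConfig k₀ w k a (single k₀ w k) := by
  simp [stkConfig, single, rest, h, below]

theorem step_root_stkConfig (M : StackSystem A K Γ) (k₀ : K) (w : List Γ) (k : K) (b : A) :
    ∃ m, (M.checker k₀).Step (rootConfig w) m (stkConfig k₀ w k b (single k₀ w k)) := by
  by_cases h : k = k₀
  · subst h
    refine ⟨.ret, ?_⟩
    simp [rootConfig, stkConfig, single, rest, popRel, ← head?_cons_below]
  · refine ⟨.int, ?_⟩
    simp [rootConfig, stkConfig, single, rest, intRel, h, below]

/-- The next letter `b` is arbitrary, since this checker ignores the control. Popping the empty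
stack is an internal move, so the symbols in `rest` are never reached. -/
theorem step_stkConfig (M : StackSystem A K Γ) (k₀ : K) (w : List Γ) (k : K) (a b : A)
    (l : List Γ) (hs : ¬ M.halting a) (hg : M.guard a k l.head?) :
    ∃ m, (M.checker k₀).Step (stkConfig k₀ w k a l) m
      (stkConfig k₀ w k b ((M.op a k).apply l)) := by
  cases ho : M.op a k with
  | nop => exact ⟨.int, by simp [stkConfig, intRel, StackOp.apply, ho, hs, hg]⟩
  | push γ => exact ⟨.call, by simp [stkConfig, pushRel, StackOp.apply, ho, hs, hg, below]⟩
  | pop =>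
    cases l with
    | nil =>
      exact ⟨.int, by simp only [List.head?_nil] at hg
                      simp [stkConfig, intRel, StackOp.apply, ho, hs, hg]⟩
    | cons c l =>
      exact ⟨.ret, by simp only [List.head?_cons] at hg
                      simp [stkConfig, popRel, StackOp.apply, ho, hs, hg, below]⟩

/-- The successors of a configuration of the checker of a stack. -/
theorem eq_of_step_stkConfig (M : StackSystem A K Γ) (k₀ : K) (w : List Γ) (k : K) (a : A)
    (l : List Γ) (m : Move) (y : Config (Loc A K Γ) (Option Γ))
    (h : (M.checker k₀).Step (stkConfig k₀ w k a l) m y) :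
    ¬ M.halting a ∧ (M.guard a k l.head? → ∃ b, y = stkConfig k₀ w k b ((M.op a k).apply l)) := by
  obtain ⟨s, u⟩ := y
  cases m with
  | int =>
    cases s <;> simp only [step_int, stkConfig, intRel, false_and] at h
    · exact ⟨h.1.1, fun hg => absurd hg h.1.2⟩
    · obtain ⟨⟨rfl, rfl, hs, hg, ho⟩, rfl⟩ := h
      refine ⟨hs, fun _ => ?_⟩
      rcases ho with ho | ⟨ho, hl⟩
      · exact ⟨_, by simp [stkConfig, ho, StackOp.apply]; rfl⟩
      · cases l with
        | nil => exact ⟨_, by simp [stkConfig, ho, StackOp.apply]; rfl⟩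
        | cons => simp at hl
  | call =>
    cases s <;> simp only [step_call, stkConfig, pushRel, false_and, exists_false] at h
    obtain ⟨θ, ⟨rfl, rfl, hs, hg, γ, ho, rfl⟩, rfl⟩ := h
    exact ⟨hs, fun _ => ⟨_, by simp [stkConfig, ho, StackOp.apply, below]; rfl⟩⟩
  | ret =>
    cases s <;> simp only [step_ret, stkConfig, popRel, false_and, exists_false] at h
    obtain ⟨θ, ⟨rfl, rfl, hs, hg, ho, hl⟩, he⟩ := h
    refine ⟨hs, fun _ => ?_⟩
    cases l with
    | nil => simp at hl
    | cons c l =>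
      simp only [below, List.cons_append, List.cons.injEq] at he
      exact ⟨_, by simp [stkConfig, ho, StackOp.apply, he.1, he.2]; rfl⟩

/-- The letter of a control location other than the root. -/
theorem exists_label_of_step (M : StackSystem A K Γ) (k₀ : K) (m : Move)
    (x y : Config (Loc A K Γ) (Option Γ)) (h : (M.checker k₀).Step x m y) :
    ∃ b, some b ∈ locLabel y.1 ∧ ∀ b', some b' ∈ locLabel y.1 → b' = b := by
  obtain ⟨s, u⟩ := x
  obtain ⟨s', u'⟩ := y
  cases s' with
  | root => cases m <;> cases s <;> simp [intRel, pushRel, popRel] at h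
  | _ => simp [locLabel]

/-- The high variable is constant after the root. -/
theorem high_step (M : StackSystem A K Γ) (k₀ : K) (m : Move)
    (x y : Config (Loc A K Γ) (Option Γ)) (h : (M.checker k₀).Step x m y)
    (hx : x.1 ≠ .root) : none ∈ locLabel x.1 ↔ none ∈ locLabel y.1 := by
  obtain ⟨s, u⟩ := x
  obtain ⟨s', u'⟩ := y
  cases m <;> cases s <;> cases s' <;> simp [intRel, pushRel, popRel, locLabel] at h hx ⊢

theorem ne_root_of_step (M : StackSystem A K Γ) (k₀ : K) (m : Move)
    (x y : Config (Loc A K Γ) (Option Γ)) (h : (M.checker k₀).Step x m y) : y.1 ≠ .root := by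
  obtain ⟨b, hb, -⟩ := M.exists_label_of_step k₀ m x y h
  intro h'
  simp [h', locLabel] at hb

/-! ### Traces of the error checker -/

/-- Every word is the low part of a trace whose high variable is true. -/
theorem exists_high_trace (M : StackSystem A K Γ) (k₀ : K) (w : List Γ) (a : ℕ → A) :
    ∃ t ∈ (M.checker k₀).tracesFrom (rootConfig w), (t 0).1 = ∅ ∧
      ∀ i, (t (i + 1)).1 = {some (a i), none} := by
  obtain ⟨c, m, hc0, hc, hI⟩ := (M.checker k₀).exists_path_of_progress
    (fun i y => if i = 0 then y = rootConfig w else y.1 = .high (a (i - 1))) (rootConfig w)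
    (by simp) (by
      intro i y hy
      refine ⟨.int, (.high (a i), y.2), ?_, by simp⟩
      by_cases h : i = 0
      · simp only [h, if_true] at hy
        simp [hy, rootConfig, intRel]
      · simp only [h, if_false] at hy
        simp [hy, intRel])
  refine ⟨_, ⟨c, m, hc0, hc, rfl⟩, ?_, ?_⟩
  · simp [hc0, rootConfig, checker, locLabel]
  · intro i
    have := hI (i + 1)
    simp at this
    simp [checker, this, locLabel]

/-- If no run reaches a halting letter, then every word is the low part of a trace whose high variable
is false: the word has no halting letter or an error in front of the first one. -/
theorem exists_low_trace_of_not_accepts (M : StackSystem A K Γ) (k₀ : K) (w : List Γ)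
    (hM : ¬ M.Accepts (single k₀ w)) (a : ℕ → A) :
    ∃ t ∈ (M.checker k₀).tracesFrom (rootConfig w), (t 0).1 = ∅ ∧
      ∀ i, (t (i + 1)).1 = {some (a i)} := by
  -- it suffices to find an invariant of configurations that can be maintained
  suffices h : ∃ I : ℕ → Config (Loc A K Γ) (Option Γ) → Prop,
      (∃ m z, (M.checker k₀).Step (rootConfig w) m z ∧ I 0 z) ∧
      (∀ i y, I i y → locLabel y.1 = {some (a i)} ∧
        ∃ m z, (M.checker k₀).Step y m z ∧ I (i + 1) z) by
    obtain ⟨I, h0, hI⟩ := h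
    obtain ⟨c, m, hc0, hc, hIc⟩ := (M.checker k₀).exists_path_of_progress
      (fun i y => if i = 0 then y = rootConfig w else I (i - 1) y) (rootConfig w)
      (by simp) (by
        intro i y hy
        by_cases h : i = 0
        · subst h
          simp only [if_true] at hy
          subst hy
          simpa using h0
        · obtain ⟨j, rfl⟩ := Nat.exists_eq_succ_of_ne_zero h
          simpa using (hI j y (by simpa using hy)).2)
    refine ⟨_, ⟨c, m, hc0, hc, rfl⟩, ?_, ?_⟩
    · simp [hc0, rootConfig, checker, locLabel]
    · intro i
      have := hIc (i + 1)
      simp only [Nat.add_eq_zero_iff, one_ne_zero, and_false, if_false, Nat.add_sub_cancel] at this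
      exact (hI i _ this).1
  have free_step : ∀ (i : ℕ) (y : Config (Loc A K Γ) (Option Γ)), y.1 = .free (a i) →
      locLabel y.1 = {some (a i)} ∧ ∃ m z, (M.checker k₀).Step y m z ∧
        z.1 = .free (a (i + 1)) := by
    intro i y hy
    exact ⟨by simp [hy, locLabel], .int, (.free (a (i + 1)), y.2), by simp [hy, intRel], rfl⟩
  by_cases hctl : (M.start (a 0) → ∃ i, (∀ j < i, M.next (a j) (a (j + 1))) ∧ M.halting (a i) ∧
      ∀ j < i, ¬ M.halting (a j))
  · by_cases hs : M.start (a 0)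
    · -- the control is correct up to the first halting letter, so some stack guard fails before
      obtain ⟨N, hn, hN, hmin⟩ := hctl hs
      have : ∃ k, ∃ p < N, ¬ M.guard (a p) k (M.stackAt a k (single k₀ w k) p).head? := by
        by_contra! hcon
        exact hM ⟨a, N, hs, hN, fun i hi => ⟨hmin i hi, hn i hi, fun k => hcon k i hi⟩⟩
      obtain ⟨k, p, hp, hg⟩ := this
      refine ⟨fun i y => y.1 = .free (a i) ∨
        (i ≤ p ∧ y = stkConfig k₀ w k (a i) (M.stackAt a k (single k₀ w k) i)), ?_, ?_⟩
      · obtain ⟨m, hm⟩ := M.step_root_stkConfig k₀ w k (a 0)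
        exact ⟨m, _, hm, Or.inr ⟨Nat.zero_le _, rfl⟩⟩
      · rintro i y (hy | ⟨hi, rfl⟩)
        · obtain ⟨h1, m, z, h2, h3⟩ := free_step i y hy
          exact ⟨h1, m, z, h2, Or.inl h3⟩
        · refine ⟨rfl, ?_⟩
          have hst := hmin i (by omega)
          -- The guard may fail before `p`; the checker then leaves for `free` at once, and at `p`
          -- it must do so.
          by_cases hgi : M.guard (a i) k (M.stackAt a k (single k₀ w k) i).head?
          · obtain ⟨m, hm⟩ := M.step_stkConfig k₀ w k (a i) (a (i + 1)) _ hst hgi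
            refine ⟨m, _, hm, Or.inr ⟨?_, rfl⟩⟩
            have : i ≠ p := by rintro rfl; exact hg hgi
            omega
          · exact ⟨.int, (.free (a (i + 1)), _), ⟨⟨hst, hgi⟩, rfl⟩, Or.inl rfl⟩
    · exact ⟨fun i y => y.1 = .free (a i), ⟨.int, (.free (a 0), _), ⟨hs, rfl⟩, rfl⟩, free_step⟩
  -- Either consecutive letters fail to fit before the first halting letter, or there is no halting
  -- letter. The location `ctl` serves both cases: it leaves for `free` at the misfit or runs
  -- forever.
  · push Not at hctl
    obtain ⟨hs, hctl⟩ := hctl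
    refine ⟨fun i y => y.1 = .free (a i) ∨
      (y.1 = .ctl (a i) ∧ ∀ j < i, ¬ M.halting (a j) ∧ M.next (a j) (a (j + 1))), ?_, ?_⟩
    · exact ⟨.int, (.ctl (a 0), _), ⟨hs, rfl⟩, Or.inr ⟨rfl, by simp⟩⟩
    · rintro i y (hy | ⟨hy, hj⟩)
      · obtain ⟨h1, m, z, h2, h3⟩ := free_step i y hy
        exact ⟨h1, m, z, h2, Or.inl h3⟩
      · refine ⟨by simp [hy, locLabel], ?_⟩
        have hst : ¬ M.halting (a i) := by
          intro hst
          obtain ⟨j, hji, hj'⟩ := hctl i (fun j h => (hj j h).2) hst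
          exact (hj j hji).1 hj'
        by_cases hn : M.next (a i) (a (i + 1))
        · refine ⟨.int, (.ctl (a (i + 1)), y.2), by simp [hy, intRel, hst, hn], Or.inr ⟨rfl, ?_⟩⟩
          intro j hji
          rcases Nat.lt_succ_iff_lt_or_eq.1 hji with h | rfl
          · exact hj j h
          · exact ⟨hst, hn⟩
        · exact ⟨.int, (.free (a (i + 1)), y.2), by simp [hy, intRel, hst, hn], Or.inl rfl⟩

/-- A run that reaches a halting letter is not the low part of a trace whose high variable is false. -/
theorem not_low_trace_of_run (M : StackSystem A K Γ) (k₀ : K) (w : List Γ) (a : ℕ → A) (N : ℕ)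
    (hs : M.start (a 0)) (hN : M.halting (a N))
    (h : ∀ i < N, ¬ M.halting (a i) ∧ M.next (a i) (a (i + 1)) ∧
      ∀ k, M.guard (a i) k (M.stackAt a k (single k₀ w k) i).head?)
    (t : Trace (Option A)) (ht : t ∈ (M.checker k₀).tracesFrom (rootConfig w))
    (ha : ∀ i, some (a i) ∈ (t (i + 1)).1) (hh : none ∉ (t 1).1) : False := by
  obtain ⟨c, m, hc0, hc, rfl⟩ := ht
  change ∀ i, some (a i) ∈ locLabel (c (i + 1)).1 at ha
  change none ∉ locLabel (c 1).1 at hh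
  -- Letters are shifted by one position because of the root. Without an error no transition to
  -- `free` is available, so the path stays in the checker chosen at its first step.
  have key : ∀ i ≤ N, (c (i + 1)).1 = .ctl (a i) ∨
      ∃ k, c (i + 1) = stkConfig k₀ w k (a i) (M.stackAt a k (single k₀ w k) i) := by
    intro i
    induction i with
    | zero =>
      intro _
      have h0 := hc 0
      have ha0 := ha 0
      rw [hc0] at h0
      rw [zero_add] at h0 ha0
      rw [zero_add]
      rcases hx : c 1 with ⟨s, u⟩
      rw [hx] at h0 ha0 hh
      cases hm : m 0 <;> rw [hm] at h0 <;> cases s <;>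
        simp [rootConfig, intRel, pushRel, popRel, locLabel] at h0 ha0 hh
      · subst ha0
        exact absurd hs h0.1
      · left; simp [ha0]
      · right
        obtain ⟨⟨hk, rfl⟩, rfl⟩ := h0
        subst ha0
        exact ⟨_, stkConfig_of_ne hk (a 0)⟩
      · right
        obtain ⟨⟨rfl, hk⟩, h0⟩ := h0
        subst ha0
        rw [← head?_cons_below] at h0
        simp only [List.cons.injEq] at h0
        exact ⟨k₀, by simp [stkConfig, stackAt, single, rest, h0.1, h0.2]⟩
    | succ i ih =>
      intro hi
      obtain ⟨hst, hnx, hg⟩ := h i (by omega)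
      have hci := hc (i + 1)
      have hai := ha (i + 1)
      rcases ih (by omega) with hx | ⟨k, hx⟩
      · left
        rcases hxx : c (i + 1) with ⟨s, u⟩
        rcases hy : c (i + 1 + 1) with ⟨s', u'⟩
        rw [hxx, hy] at hci
        rw [hy] at hai
        rw [hxx] at hx
        simp only at hx
        subst hx
        cases hm : m (i + 1) <;> rw [hm] at hci <;> cases s' <;>
          simp [intRel, pushRel, popRel, locLabel] at hci hai
        · subst hai
          exact absurd hnx hci.1.2
        · simp [hai]
      · right
        rw [hx] at hci
        obtain ⟨-, hb⟩ := M.eq_of_step_stkConfig _ _ _ _ _ _ _ hci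
        obtain ⟨b, hb⟩ := hb (hg k)
        rw [hb] at hai
        simp [stkConfig, locLabel] at hai
        subst hai
        exact ⟨k, hb⟩
  -- A checker that reads a halting letter has no successor, but the path is infinite.
  have hcN := hc (N + 1)
  rcases key N le_rfl with hx | ⟨k, hx⟩
  · rcases hxx : c (N + 1) with ⟨s, u⟩
    rcases hy : c (N + 1 + 1) with ⟨s', u'⟩
    rw [hxx, hy] at hcN
    rw [hxx] at hx
    simp only at hx
    subst hx
    cases hm : m (N + 1) <;> rw [hm] at hcN <;> cases s' <;>
      simp [intRel, pushRel, popRel, hN] at hcN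
  · rw [hx] at hcN
    exact (M.eq_of_step_stkConfig _ _ _ _ _ _ _ hcN).1 hN

/-- The error checker has generalised non-interference if and only if no run is free of errors. -/
theorem gniOn_checker_iff (M : StackSystem A K Γ) (k₀ : K) (w : List Γ)
    (hM : ∃ a, ¬ M.start a) :
    GNIOn (Set.range some) {none} ((M.checker k₀).tracesFrom (rootConfig w)) ↔
      ¬ M.Accepts (single k₀ w) := by
  constructor
  · rintro hG ⟨a, N, hs, hN, h⟩
    obtain ⟨b, hb⟩ := hM
    obtain ⟨t₁, ht₁, -, h₁⟩ := M.exists_high_trace k₀ w a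
    -- A word beginning with a letter that is not a start letter gives a second trace on which the
    -- high variable is false.
    obtain ⟨c, m, hc0, hc, hI⟩ := (M.checker k₀).exists_path_of_progress
      (fun i y => if i = 0 then y = rootConfig w else y.1 = .free b) (rootConfig w)
      (by simp) (by
        intro i y hy
        refine ⟨.int, (.free b, y.2), ?_, by simp⟩
        by_cases h : i = 0
        · simp only [h, if_true] at hy
          simp [hy, rootConfig, intRel, hb]
        · simp only [h, if_false] at hy
          simp [hy, intRel])
    obtain ⟨t₃, ht₃, hL, hH⟩ := hG t₁ ht₁ _ ⟨c, m, hc0, hc, rfl⟩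
    refine M.not_low_trace_of_run k₀ w a N hs hN h t₃ ht₃ (fun i => ?_) ?_
    · rw [← hL (i + 1) _ ⟨a i, rfl⟩, h₁]
      simp
    · rw [← hH 1 _ rfl]
      have := hI 1
      simp at this
      simp [checker, this, locLabel]
  · rintro hacc t₁ ⟨c₁, m₁, h10, h1, rfl⟩ t₂ ⟨c₂, m₂, h20, h2, rfl⟩
    choose a ha ha' using fun i => M.exists_label_of_step k₀ _ _ _ (h1 i)
    have hne : ∀ i, (c₂ (i + 1)).1 ≠ .root := fun i => M.ne_root_of_step k₀ _ _ _ (h2 i)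
    have hconst : ∀ i, none ∈ locLabel (c₂ (i + 1)).1 ↔ none ∈ locLabel (c₂ 1).1 := by
      intro i
      induction i with
      | zero => simp
      | succ i ih => rw [← ih, M.high_step k₀ _ _ _ (h2 (i + 1)) (hne i)]
    -- The low word comes from the first trace; from the second only the constant value of the high
    -- variable matters.
    obtain ⟨t₃, ht₃, h30, h3⟩ : ∃ t ∈ (M.checker k₀).tracesFrom (rootConfig w), (t 0).1 = ∅ ∧
        ∀ i, (t (i + 1)).1 = {x | x = some (a i) ∨ x = none ∧ none ∈ locLabel (c₂ 1).1} := by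
      by_cases hh : none ∈ locLabel (c₂ 1).1
      · obtain ⟨t, ht, h0, h'⟩ := M.exists_high_trace k₀ w a
        exact ⟨t, ht, h0, fun i => by rw [h' i]; ext; simp [hh]⟩
      · obtain ⟨t, ht, h0, h'⟩ := M.exists_low_trace_of_not_accepts k₀ w hacc a
        exact ⟨t, ht, h0, fun i => by rw [h' i]; ext; simp [hh]⟩
    refine ⟨t₃, ht₃, ?_, ?_⟩
    · rintro i _ ⟨b, rfl⟩
      cases i with
      | zero => simp [h30, h10, rootConfig, checker, locLabel]
      | succ i =>
        rw [h3]
        constructor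
        · intro hb
          simp [ha' i b hb]
        · rintro (hb | hb)
          · rw [hb]
            exact ha i
          · simp at hb
    · rintro i _ rfl
      cases i with
      | zero => simp [h30, h20, rootConfig, checker, locLabel]
      | succ i =>
        rw [h3]
        simpa [checker] using hconst i

end StackSystem

/-! ### Unfolding and renaming traces -/

theorem PDS.mem_tracesFrom_iff {AP S Θ : Type} (P : PDS AP S Θ) (x : Config S Θ)
    (t : Trace AP) : t ∈ P.tracesFrom x ↔
      ∃ y, P.Step x (t 0).2 y ∧ (t 0).1 = P.label x.1 ∧ (fun i => t (i + 1)) ∈ P.tracesFrom y := by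
  constructor
  · rintro ⟨c, m, rfl, hc, rfl⟩
    exact ⟨c 1, hc 0, rfl, fun i => c (i + 1), fun i => m (i + 1), rfl, fun i => hc (i + 1), rfl⟩
  · rintro ⟨y, hs, hl, c, m, rfl, hc, ht⟩
    refine ⟨fun i => Nat.casesOn i x c, fun i => Nat.casesOn i (t 0).2 m, rfl, ?_, ?_⟩
    · rintro (_ | i)
      · exact hs
      · exact hc i
    · funext i
      cases i with
      | zero => exact Prod.ext hl rfl
      | succ i => exact congrFun ht i

/-- A forced first step does not matter for generalised non-interference. -/
theorem PDS.gniOn_tracesFrom_of_forced {AP S Θ : Type} (P : PDS AP S Θ) (L H : Set AP)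
    (x y : Config S Θ) (m : Move) (h : ∀ m' y', P.Step x m' y' ↔ m' = m ∧ y' = y) :
    GNIOn L H (P.tracesFrom x) ↔ GNIOn L H (P.tracesFrom y) := by
  have key : ∀ t, t ∈ P.tracesFrom x ↔
      t 0 = (P.label x.1, m) ∧ (fun i => t (i + 1)) ∈ P.tracesFrom y := by
    intro t
    rw [P.mem_tracesFrom_iff]
    simp only [h, Prod.ext_iff (x := t 0)]
    constructor
    · rintro ⟨_, ⟨h1, rfl⟩, h2, h3⟩
      exact ⟨⟨h2, h1⟩, h3⟩
    · rintro ⟨⟨h2, h1⟩, h3⟩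
      exact ⟨_, ⟨h1, rfl⟩, h2, h3⟩
  let cons : Trace AP → Trace AP := fun t i => Nat.casesOn i (P.label x.1, m) t
  have hcons : ∀ t ∈ P.tracesFrom y, cons t ∈ P.tracesFrom x :=
    fun t ht => (key _).2 ⟨rfl, ht⟩
  constructor
  · intro hG t₁ h₁ t₂ h₂
    obtain ⟨t₃, h₃, hL, hH⟩ := hG _ (hcons t₁ h₁) _ (hcons t₂ h₂)
    exact ⟨_, ((key _).1 h₃).2, fun i => hL (i + 1), fun i => hH (i + 1)⟩
  · intro hG t₁ h₁ t₂ h₂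
    rw [key] at h₁ h₂
    obtain ⟨t₃, h₃, hL, hH⟩ := hG _ h₁.2 _ h₂.2
    refine ⟨_, hcons t₃ h₃, ?_, ?_⟩
    · rintro (_ | i) a ha
      · rw [h₁.1]; rfl
      · exact hL i a ha
    · rintro (_ | i) a ha
      · rw [h₂.1]; rfl
      · exact hH i a ha

/-- Renaming of the atomic propositions in a trace. -/
def mapTrace {AP AP' : Type} (e : AP → AP') (t : Trace AP) : Trace AP' :=
  fun i => (e '' (t i).1, (t i).2)

theorem gniOn_image_mapTrace {AP AP' : Type} (e : AP ≃ AP') (L H : Set AP)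
    (T : Set (Trace AP)) : GNIOn (e '' L) (e '' H) (mapTrace e '' T) ↔ GNIOn L H T := by
  simp only [GNIOn, mapTrace, Set.forall_mem_image, Set.exists_mem_image,
    e.injective.mem_set_image]

/-! ### Codes that load the stack -/

/-- The number of a transition, from the numbers of locations and of stack symbols. -/
def numTrans {S Θ : Type} (f : S → ℕ) (g : Θ → ℕ) : Trans S Θ → Trans ℕ ℕ
  | .inl (p, q) => .inl (f p, f q)
  | .inr (.inl (p, q, θ)) => .inr (.inl (f p, f q, g θ))
  | .inr (.inr (p, θ, q)) => .inr (.inr (f p, g θ, f q))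

/-- Transitions that push the listed symbols. The location `F + j` has `j` symbols to push. -/
def loadTrans (F : ℕ) : List ℕ → List (Trans ℕ ℕ)
  | [] => []
  | x :: xs => .inr (.inl (F + (xs.length + 1), F + xs.length, x)) :: loadTrans F xs

/-- A suffix is determined by its length, which is what makes the loading phase deterministic. -/
theorem mem_loadTrans (F : ℕ) (l : List ℕ) (r : Trans ℕ ℕ) :
    r ∈ loadTrans F l ↔ ∃ x xs, (x :: xs) <:+ l ∧
      r = .inr (.inl (F + (xs.length + 1), F + xs.length, x)) := by
  induction l with
  | nil => simp [loadTrans]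
  | cons y l ih =>
    simp only [loadTrans, List.mem_cons, ih, List.suffix_cons_iff, List.cons.injEq]
    constructor
    · rintro (rfl | ⟨x, xs, h, rfl⟩)
      · exact ⟨y, l, Or.inl ⟨rfl, rfl⟩, rfl⟩
      · exact ⟨x, xs, Or.inr h, rfl⟩
    · rintro ⟨x, xs, ⟨rfl, rfl⟩ | h, rfl⟩
      · exact Or.inl rfl
      · exact Or.inr ⟨x, xs, h, rfl⟩

/-- A configuration of `Q` as a configuration of the coded system. -/
def liftConfig {S Θ : Type} {F G : ℕ} (eS : S ≃ Fin (F + 1)) (eΘ : Θ ≃ Fin G) (n : ℕ)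
    (x : Config S Θ) :
    Config (Fin (F + 1 + n)) (Fin G) := ((eS x.1).castAdd n, x.2.map eΘ)

theorem liftConfig_injective {S Θ : Type} {F G : ℕ} (eS : S ≃ Fin (F + 1)) (eΘ : Θ ≃ Fin G)
    (n : ℕ) :
    Function.Injective (liftConfig (n := n) eS eΘ) := by
  rintro ⟨s, u⟩ ⟨s', u'⟩ h
  simp only [liftConfig, Prod.mk.injEq, Fin.castAdd_inj, EmbeddingLike.apply_eq_iff_eq] at h
  exact Prod.ext h.1 ((List.map_injective_iff.2 eΘ.injective) h.2)

section Load

variable {AP S Θ : Type} [Finite AP] [Finite S] [Finite Θ] {k F G : ℕ}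

/-- The code of the pushdown system that pushes the listed symbols and then behaves as `Q` from the
location with number `F`. -/
noncomputable def loadCode (Q : PDS AP S Θ) (eA : AP ≃ Fin k) (eS : S ≃ Fin (F + 1))
    (eΘ : Θ ≃ Fin G) (l : List ℕ) : Code where
  numStates := F + 1 + l.length
  numStack := G
  init := [F + l.length]
  trans := (Set.toFinite (numTrans (fun s => (eS s : ℕ)) (fun θ => (eΘ θ : ℕ)) ''
    Q.trans)).toFinset.toList ++ loadTrans F l
  label := (Set.toFinite ((fun p : S × AP => ((eS p.1 : ℕ), (eA p.2 : ℕ))) ''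
    {p | p.2 ∈ Q.label p.1})).toFinset.toList

/-- The coded system. -/
noncomputable def loadPDS (Q : PDS AP S Θ) (eA : AP ≃ Fin k) (eS : S ≃ Fin (F + 1))
    (eΘ : Θ ≃ Fin G) (l : List ℕ) : PDS (Fin k) (Fin (F + 1 + l.length)) (Fin G) :=
  (loadCode Q eA eS eΘ l).toPDS k

theorem mem_trans_loadPDS (Q : PDS AP S Θ) (eA : AP ≃ Fin k) (eS : S ≃ Fin (F + 1))
    (eΘ : Θ ≃ Fin G) (l : List ℕ) (r : Trans (Fin (F + 1 + l.length)) (Fin G)) :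
    r ∈ (loadPDS Q eA eS eΘ l).trans ↔
      (∃ t ∈ Q.trans, numTrans (fun s => (eS s : ℕ)) (fun θ => (eΘ θ : ℕ)) t = natTrans r) ∨
        natTrans r ∈ loadTrans F l := by
  simp [loadPDS, Code.toPDS, loadCode]

theorem mem_init_loadPDS (Q : PDS AP S Θ) (eA : AP ≃ Fin k) (eS : S ≃ Fin (F + 1))
    (eΘ : Θ ≃ Fin G) (l : List ℕ) (q : Fin (F + 1 + l.length)) :
    q ∈ (loadPDS Q eA eS eΘ l).init ↔ (q : ℕ) = F + l.length :=
  List.mem_singleton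

theorem label_loadCode (Q : PDS AP S Θ) (eA : AP ≃ Fin k) (eS : S ≃ Fin (F + 1))
    (eΘ : Θ ≃ Fin G) (l : List ℕ) (s : S) :
    (loadPDS Q eA eS eΘ l).label ((eS s).castAdd l.length) = eA '' Q.label s := by
  ext a
  simp only [loadPDS, Code.toPDS, loadCode, Finset.mem_toList, Set.Finite.mem_toFinset, Set.mem_image,
    Set.mem_ofPred_eq, Prod.exists, Prod.mk.injEq, Fin.val_castAdd]
  constructor
  · rintro ⟨s', a', h, h1, h2⟩
    obtain rfl := eS.injective (Fin.ext h1)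
    exact ⟨a', h, Fin.ext h2⟩
  · rintro ⟨a', h, rfl⟩
    exact ⟨s, a', h, rfl, rfl⟩

/-- Loading transitions leave only locations numbered above `F`, so those of `Q` gain no successors.
-/
theorem step_liftConfig (Q : PDS AP S Θ) (eA : AP ≃ Fin k) (eS : S ≃ Fin (F + 1))
    (eΘ : Θ ≃ Fin G) (l : List ℕ) (x : Config S Θ) (m : Move)
    (y : Config (Fin (F + 1 + l.length)) (Fin G)) :
    (loadPDS Q eA eS eΘ l).Step (liftConfig eS eΘ l.length x) m y ↔
      ∃ z, y = liftConfig eS eΘ l.length z ∧ Q.Step x m z := by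
  obtain ⟨s, u⟩ := x
  obtain ⟨q, v⟩ := y
  have hload : ∀ (r : Trans ℕ ℕ), r ∈ loadTrans F l → ∀ j x, r = .inr (.inl (↑(eS s), j, x)) →
      False := by
    intro r hr j x hx
    rw [mem_loadTrans] at hr
    obtain ⟨x', xs, -, rfl⟩ := hr
    simp only [Sum.inr.injEq, Sum.inl.injEq, Prod.mk.injEq] at hx
    have := (eS s).2
    omega
  cases m with
  | int =>
    simp only [PDS.Step, mem_trans_loadPDS, liftConfig, natTrans, Fin.val_castAdd]
    constructor
    · rintro ⟨⟨t, ht, h⟩ | h, rfl⟩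
      · rcases t with (⟨p, p'⟩ | ⟨⟨p, p', θ⟩ | ⟨p, θ, p'⟩⟩) <;> simp [numTrans] at h
        obtain rfl := eS.injective (Fin.ext h.1)
        exact ⟨(p', u), Prod.ext (Fin.ext h.2.symm) rfl, ht, rfl⟩
      · rw [mem_loadTrans] at h
        obtain ⟨_, _, _, h⟩ := h
        simp at h
    · rintro ⟨⟨p', u'⟩, h, ht, rfl⟩
      obtain ⟨rfl, rfl⟩ := Prod.mk.inj h
      exact ⟨Or.inl ⟨_, ht, rfl⟩, rfl⟩
  | call =>
    simp only [PDS.Step, mem_trans_loadPDS, liftConfig, natTrans, Fin.val_castAdd]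
    constructor
    · rintro ⟨θ', ⟨t, ht, h⟩ | h, rfl⟩
      · rcases t with (⟨p, p'⟩ | ⟨⟨p, p', θ⟩ | ⟨p, θ, p'⟩⟩) <;> simp [numTrans] at h
        obtain rfl := eS.injective (Fin.ext h.1)
        obtain rfl : eΘ θ = θ' := Fin.ext h.2.2
        exact ⟨(p', θ :: u), Prod.ext (Fin.ext h.2.1.symm) rfl, θ, ht, rfl⟩
      · exact (hload _ h _ _ rfl).elim
    · rintro ⟨⟨p', u'⟩, h, θ, ht, rfl⟩
      obtain ⟨rfl, rfl⟩ := Prod.mk.inj h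
      exact ⟨eΘ θ, Or.inl ⟨_, ht, rfl⟩, rfl⟩
  | ret =>
    simp only [PDS.Step, mem_trans_loadPDS, liftConfig, natTrans, Fin.val_castAdd]
    constructor
    · rintro ⟨θ', ⟨t, ht, h⟩ | h, hu⟩
      · rcases t with (⟨p, p'⟩ | ⟨⟨p, p', θ⟩ | ⟨p, θ, p'⟩⟩) <;> simp [numTrans] at h
        obtain rfl := eS.injective (Fin.ext h.1)
        obtain rfl : eΘ θ = θ' := Fin.ext h.2.1
        obtain ⟨θ'', u', rfl, h1, h2⟩ := List.map_eq_cons_iff.1 hu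
        obtain rfl := eΘ.injective h1
        exact ⟨(p', u'), Prod.ext (Fin.ext h.2.2.symm) h2.symm, θ'', ht, rfl⟩
      · rw [mem_loadTrans] at h
        obtain ⟨_, _, _, h⟩ := h
        simp at h
    · rintro ⟨⟨p', u'⟩, h, θ, ht, hu⟩
      simp only at hu
      subst hu
      obtain ⟨rfl, rfl⟩ := Prod.mk.inj h
      exact ⟨eΘ θ, Or.inl ⟨_, ht, rfl⟩, rfl⟩

theorem tracesFrom_liftConfig (Q : PDS AP S Θ) (eA : AP ≃ Fin k) (eS : S ≃ Fin (F + 1))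
    (eΘ : Θ ≃ Fin G) (l : List ℕ) (x : Config S Θ) :
    (loadPDS Q eA eS eΘ l).tracesFrom (liftConfig eS eΘ l.length x) =
      mapTrace eA '' Q.tracesFrom x := by
  ext t
  constructor
  · rintro ⟨c, m, h0, hc, rfl⟩
    have hz : ∀ i, ∃ z, c i = liftConfig eS eΘ l.length z := by
      intro i
      induction i with
      | zero => exact ⟨x, h0⟩
      | succ i ih =>
        obtain ⟨z, hz⟩ := ih
        have := hc i
        rw [hz, step_liftConfig] at this
        obtain ⟨z', hz', -⟩ := this
        exact ⟨z', hz'⟩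
    choose z hz using hz
    refine ⟨_, ⟨z, m, ?_, ?_, rfl⟩, ?_⟩
    · exact liftConfig_injective eS eΘ l.length ((hz 0).symm.trans h0)
    · intro i
      have := hc i
      rw [hz i, step_liftConfig] at this
      obtain ⟨z', hz', hs⟩ := this
      rw [hz (i + 1)] at hz'
      rwa [liftConfig_injective eS eΘ l.length hz']
    · funext i
      simp only [mapTrace, hz i]
      exact Prod.ext (label_loadCode Q eA eS eΘ l _).symm rfl
  · rintro ⟨_, ⟨c, m, rfl, hc, rfl⟩, rfl⟩
    refine ⟨fun i => liftConfig eS eΘ l.length (c i), m, rfl, ?_, ?_⟩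
    · intro i
      exact (step_liftConfig Q eA eS eΘ l _ _ _).2 ⟨_, rfl, hc i⟩
    · funext i
      exact Prod.ext (label_loadCode Q eA eS eΘ l _).symm rfl

/-- The location with number `F + n`. -/
def loadLoc (F : ℕ) {N n : ℕ} (h : n ≤ N) : Fin (F + 1 + N) := ⟨F + n, by omega⟩

theorem step_loadLoc (Q : PDS AP S Θ) (eA : AP ≃ Fin k) (eS : S ≃ Fin (F + 1))
    (eΘ : Θ ≃ Fin G) (l : List ℕ) (x : Fin G) (xs : List ℕ) (hx : ((x : ℕ) :: xs) <:+ l)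
    (u : List (Fin G)) (m : Move) (y : Config (Fin (F + 1 + l.length)) (Fin G)) :
    (loadPDS Q eA eS eΘ l).Step
        (loadLoc F (n := xs.length + 1) hx.length_le, u) m y ↔
      m = .call ∧ y = (loadLoc F (Nat.le_of_succ_le hx.length_le), x :: u) := by
  obtain ⟨q, v⟩ := y
  -- Conversely, transitions of `Q` leave only locations numbered at most `F`.
  have hfix : ∀ t : Trans S Θ, ∀ j z, numTrans (fun s => (eS s : ℕ)) (fun θ => (eΘ θ : ℕ)) t ≠
        .inl (F + (xs.length + 1), j) ∧
      numTrans (fun s => (eS s : ℕ)) (fun θ => (eΘ θ : ℕ)) t ≠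
        .inr (.inl (F + (xs.length + 1), j, z)) ∧
      numTrans (fun s => (eS s : ℕ)) (fun θ => (eΘ θ : ℕ)) t ≠
        .inr (.inr (F + (xs.length + 1), z, j)) := by
    intro t j z
    rcases t with (⟨p, p'⟩ | ⟨⟨p, p', θ⟩ | ⟨p, θ, p'⟩⟩) <;>
      · have := (eS p).2
        simp only [numTrans, ne_eq, Sum.inl.injEq, Sum.inr.injEq, Prod.mk.injEq, reduceCtorEq,
          not_false_eq_true, true_and, and_true]
        omega
  cases m with
  | int =>
    simp only [PDS.Step, mem_trans_loadPDS, natTrans, loadLoc, reduceCtorEq,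
      false_and, iff_false, not_and]
    rintro (⟨t, -, h⟩ | h)
    · exact absurd h (hfix t _ 0).1
    · rw [mem_loadTrans] at h
      obtain ⟨_, _, _, h⟩ := h
      simp at h
  | call =>
    simp only [PDS.Step, mem_trans_loadPDS, natTrans, loadLoc, true_and]
    constructor
    · rintro ⟨θ, ⟨t, -, h⟩ | h, rfl⟩
      · exact absurd h (hfix t _ _).2.1
      · rw [mem_loadTrans] at h
        obtain ⟨x', xs', hs, h⟩ := h
        simp only [Sum.inr.injEq, Sum.inl.injEq, Prod.mk.injEq] at h
        have hlen : xs.length = xs'.length := by omega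
        have heq := (List.suffix_of_suffix_length_le hx hs (by simp [hlen])).eq_of_length
          (by simp [hlen])
        obtain ⟨h1, rfl⟩ := List.cons.inj heq
        refine Prod.ext (Fin.ext h.2.1) ?_
        simp only [List.cons.injEq, and_true]
        exact Fin.ext (h.2.2.trans h1.symm)
    · intro h
      obtain ⟨rfl, rfl⟩ := Prod.mk.inj h
      exact ⟨x, Or.inr ((mem_loadTrans _ _ _).2 ⟨x, xs, hx, rfl⟩), rfl⟩
  | ret =>
    simp only [PDS.Step, mem_trans_loadPDS, natTrans, loadLoc, reduceCtorEq,
      false_and, iff_false, not_exists, not_and]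
    rintro θ (⟨t, -, h⟩ | h)
    · exact absurd h (hfix t _ _).2.2
    · rw [mem_loadTrans] at h
      obtain ⟨_, _, _, h⟩ := h
      simp at h

/-- Each loading step is forced, so it can be dropped; pushing in order reverses the list. -/
theorem gniOn_loadLoc (Q : PDS AP S Θ) (eA : AP ≃ Fin k) (eS : S ≃ Fin (F + 1))
    (eΘ : Θ ≃ Fin G) (L H : Set (Fin k)) (l : List ℕ) (xs : List (Fin G))
    (hx : xs.map Fin.val <:+ l) (u : List (Fin G)) :
    GNIOn L H ((loadPDS Q eA eS eΘ l).tracesFrom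
        (loadLoc F (n := xs.length) (by simpa using hx.length_le), u)) ↔
      GNIOn L H ((loadPDS Q eA eS eΘ l).tracesFrom
        (loadLoc F (Nat.zero_le l.length), xs.reverse ++ u)) := by
  induction xs generalizing u with
  | nil => rfl
  | cons x xs ih =>
    have hxs : xs.map Fin.val <:+ l := (List.suffix_cons _ _).trans hx
    have hstep := fun m y => step_loadLoc Q eA eS eΘ l x (xs.map Fin.val) hx u m y
    have := PDS.gniOn_tracesFrom_of_forced _ L H _ _ _ hstep
    simp only [List.length_map] at this
    rw [List.reverse_cons, List.append_assoc, List.singleton_append, ← ih hxs (x :: u)]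
    exact this

/-- Generalised non-interference of the coded system. -/
theorem models_loadCode (Q : PDS AP S Θ) (eA : AP ≃ Fin k) (eS : S ≃ Fin (F + 1))
    (eΘ : Θ ≃ Fin G) (L H : Finset (Fin k)) (s : S) (hs : eS s = Fin.last F) (l : List Θ) :
    ((loadCode Q eA eS eΘ (l.map fun θ => (eΘ θ : ℕ))).toPDS k).Models (gni L H) ↔
      GNIOn (eA ⁻¹' L) (eA ⁻¹' H) (Q.tracesFrom (s, l.reverse)) := by
  change (loadPDS Q eA eS eΘ (l.map fun θ => (eΘ θ : ℕ))).Models (gni L H) ↔ _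
  rw [PDS.models_gni, ← gniOn_image_mapTrace eA,
    ← tracesFrom_liftConfig Q eA eS eΘ (l.map fun θ => (eΘ θ : ℕ)),
    Equiv.image_preimage, Equiv.image_preimage]
  have h := gniOn_loadLoc Q eA eS eΘ (L : Set (Fin k)) H (l.map fun θ => (eΘ θ : ℕ))
    (l.map eΘ) (by simp [Function.comp_def]) []
  -- Loading ends in location `F`, which is `s` itself because `s` has the last number among the
  -- locations of `Q`.
  have hroot : (loadLoc F (Nat.zero_le (l.map fun θ => (eΘ θ : ℕ)).length),
      (l.map eΘ).reverse ++ []) =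
      liftConfig eS eΘ (l.map fun θ => (eΘ θ : ℕ)).length (s, l.reverse) := by
    simp [liftConfig, hs, loadLoc, Fin.ext_iff]
  rw [hroot] at h
  rw [← h]
  congr! 1
  ext t
  constructor
  · rintro ⟨c, m, ⟨h1, h2, h3⟩, rfl⟩
    rw [mem_init_loadPDS] at h1
    exact ⟨c, m, Prod.ext (Fin.ext (by simpa [loadLoc] using h1)) h2, h3, rfl⟩
  · rintro ⟨c, m, h1, h3, rfl⟩
    refine ⟨c, m, ⟨?_, by rw [h1], h3⟩, rfl⟩
    rw [mem_init_loadPDS, h1]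
    simp [loadLoc]

end Load

/-! ### Stack machines as systems with several stacks -/

namespace StackMachine

open Turing StateTransition Turing.TM2.Stmt

variable {K Γ Λ σ : Type}

/-- The stack that a statement reads. -/
def readStack : Option (TM2.Stmt (fun _ : K => Γ) Λ σ) → Option K
  | some (peek k _ _) => some k
  | some (pop k _ _) => some k
  | _ => none

/-- The next statement and the next internal state, given the symbol that is read. -/
def nextStmt (M : Λ → TM2.Stmt (fun _ : K => Γ) Λ σ) :
    Option (TM2.Stmt (fun _ : K => Γ) Λ σ) → σ → Option Γ →
      Option (Option (TM2.Stmt (fun _ : K => Γ) Λ σ) × σ)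
  | some (push _ _ q), v, _ => some (some q, v)
  | some (peek _ f q), v, x => some (some q, f v x)
  | some (pop _ f q), v, x => some (some q, f v x)
  | some (load f q), v, _ => some (some q, f v)
  | some (branch f q₁ q₂), v, _ => some (some (cond (f v) q₁ q₂), v)
  | some (goto f), v, _ => some (some (M (f v)), v)
  | some halt, v, _ => some (none, v)
  | none, _, _ => none

/-- The operation of a statement on a stack. -/
def stmtOp [DecidableEq K] :
    Option (TM2.Stmt (fun _ : K => Γ) Λ σ) → σ → K → StackOp Γ
  | some (push k f _), v, k' => if k' = k then .push (f v) else .nop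
  | some (pop k _ _), _, k' => if k' = k then .pop else .nop
  | _, _, _ => .nop

/-- A configuration in the middle of a step of the stack machine: the statement that remains to be
executed, the internal state and the stacks. -/
abbrev SmallCfg (K Γ Λ σ : Type) : Type :=
  Option (TM2.Stmt (fun _ : K => Γ) Λ σ) × σ × (K → List Γ)

/-- The symbol that is read in a configuration. -/
def readTop (c : SmallCfg K Γ Λ σ) : Option Γ :=
  (readStack c.1).bind fun k => (c.2.2 k).head?

/-- Execution of the first instruction of a statement. -/
def smallStep [DecidableEq K] (M : Λ → TM2.Stmt (fun _ : K => Γ) Λ σ) (c : SmallCfg K Γ Λ σ) :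
    Option (SmallCfg K Γ Λ σ) :=
  (nextStmt M c.1 c.2.1 (readTop c)).map fun p =>
    (p.1, p.2, fun k => (stmtOp c.1 c.2.1 k).apply (c.2.2 k))

/-- A configuration of the stack machine as a configuration of its small-step semantics. -/
def toSmall (M : Λ → TM2.Stmt (fun _ : K => Γ) Λ σ) (c : TM2.Cfg (fun _ : K => Γ) Λ σ) :
    SmallCfg K Γ Λ σ := (c.l.map M, c.var, c.stk)

theorem reaches₁_stepAux [DecidableEq K] (M : Λ → TM2.Stmt (fun _ : K => Γ) Λ σ)
    (q : TM2.Stmt (fun _ : K => Γ) Λ σ) (v : σ) (S : K → List Γ) :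
    Reaches₁ (smallStep M) (some q, v, S) (toSmall M (TM2.stepAux q v S)) := by
  induction q generalizing v S with
  | push k f q ih =>
    refine Relation.TransGen.head (b := (some q, v, Function.update S k (f v :: S k))) ?_ (ih _ _)
    simp only [smallStep, nextStmt, stmtOp, Option.map_some, Option.mem_def, Option.some.injEq,
      Prod.mk.injEq, true_and]
    funext k'
    by_cases h : k' = k
    · subst h
      simp [StackOp.apply]
    · simp [h, StackOp.apply]
  | peek k f q ih => exact Relation.TransGen.head rfl (ih _ _)
  | pop k f q ih =>
    refine Relation.TransGen.head
      (b := (some q, f v (S k).head?, Function.update S k (S k).tail)) ?_ (ih _ _)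
    simp only [smallStep, nextStmt, stmtOp, readTop, readStack, Option.map_some, Option.mem_def,
      Option.some.injEq, Prod.mk.injEq, true_and, Option.bind_some]
    funext k'
    by_cases h : k' = k
    · subst h
      simp [StackOp.apply]
    · simp [h, StackOp.apply]
  | load f q ih => exact Relation.TransGen.head rfl (ih _ _)
  | branch f q₁ q₂ ih₁ ih₂ =>
    cases h : f v
    · refine Relation.TransGen.head (b := (some q₂, v, S)) ?_ ?_
      · simp [smallStep, nextStmt, h, stmtOp, StackOp.apply]
      · simpa [h, Reaches₁] using ih₂ v S
    · refine Relation.TransGen.head (b := (some q₁, v, S)) ?_ ?_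
      · simp [smallStep, nextStmt, h, stmtOp, StackOp.apply]
      · simpa [h, Reaches₁] using ih₁ v S
  | goto f => exact Relation.TransGen.single rfl
  | halt => exact Relation.TransGen.single rfl

/-- A step of `TM2` runs a whole statement up to its `goto` or `halt`, hence is a non-empty sequence
of small steps. -/
theorem smallStep_eval_dom [DecidableEq K] (M : Λ → TM2.Stmt (fun _ : K => Γ) Λ σ)
    (c : TM2.Cfg (fun _ : K => Γ) Λ σ) :
    (eval (smallStep M) (toSmall M c)).Dom ↔ (eval (TM2.step M) c).Dom := by
  refine tr_eval_dom (tr := fun a b => toSmall M a = b) (fun_respects.2 ?_) rfl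
  rintro ⟨l, v, S⟩
  cases l with
  | none => rfl
  | some l => exact reaches₁_stepAux M (M l) v S

theorem exists_seq_of_reaches {α : Type} {f : α → Option α} {a b : α} (h : Reaches f a b) :
    ∃ (e : ℕ → α) (N : ℕ), e 0 = a ∧ e N = b ∧ ∀ i < N, f (e i) = some (e (i + 1)) := by
  induction h using Relation.ReflTransGen.head_induction_on with
  | refl => exact ⟨fun _ => b, 0, rfl, rfl, by simp⟩
  | @head a c hac _ ih =>
    obtain ⟨e, N, h0, hN, he⟩ := ih
    refine ⟨fun i => Nat.casesOn i a e, N + 1, rfl, hN, ?_⟩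
    rintro (_ | i) hi
    · simpa [h0] using hac
    · exact he i (by omega)

theorem reaches_of_seq {α : Type} {f : α → Option α} (e : ℕ → α) (N : ℕ)
    (he : ∀ i < N, f (e i) = some (e (i + 1))) : Reaches f (e 0) (e N) := by
  induction N with
  | zero => exact Relation.ReflTransGen.refl
  | succ N ih => exact (ih fun i hi => he i (by omega)).tail (he N (by omega))

/-- This keeps a run within finitely many statements, so that finitely many letters suffice. -/
theorem nextStmt_mem_stmts [Inhabited Λ] (M : Λ → TM2.Stmt (fun _ : K => Γ) Λ σ) (S : Finset Λ)
    (hS : TM2.Supports M S) {q q' : Option (TM2.Stmt (fun _ : K => Γ) Λ σ)} {v v' : σ}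
    {x : Option Γ} (h : nextStmt M q v x = some (q', v')) (hq : q ∈ TM2.stmts M S) :
    q' ∈ TM2.stmts M S := by
  match q, h, hq with
  | some (push _ _ q), h, hq =>
    simp only [nextStmt, Option.some.injEq, Prod.mk.injEq] at h
    exact h.1 ▸ TM2.stmts_trans (by simp [TM2.stmts₁, TM2.stmts₁_self]) hq
  | some (peek _ _ q), h, hq =>
    simp only [nextStmt, Option.some.injEq, Prod.mk.injEq] at h
    exact h.1 ▸ TM2.stmts_trans (by simp [TM2.stmts₁, TM2.stmts₁_self]) hq
  | some (pop _ _ q), h, hq =>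
    simp only [nextStmt, Option.some.injEq, Prod.mk.injEq] at h
    exact h.1 ▸ TM2.stmts_trans (by simp [TM2.stmts₁, TM2.stmts₁_self]) hq
  | some (load _ q), h, hq =>
    simp only [nextStmt, Option.some.injEq, Prod.mk.injEq] at h
    exact h.1 ▸ TM2.stmts_trans (by simp [TM2.stmts₁, TM2.stmts₁_self]) hq
  | some (branch f q₁ q₂), h, hq =>
    simp only [nextStmt, Option.some.injEq, Prod.mk.injEq] at h
    refine h.1 ▸ TM2.stmts_trans ?_ hq
    cases f v <;> simp [TM2.stmts₁, TM2.stmts₁_self]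
  | some (goto f), h, hq =>
    simp only [nextStmt, Option.some.injEq, Prod.mk.injEq] at h
    have hf : f v ∈ S := TM2.stmts_supportsStmt hS hq v
    rw [← h.1]
    simp only [TM2.stmts, Finset.some_mem_insertNone, Finset.mem_biUnion]
    exact ⟨_, hf, TM2.stmts₁_self⟩
  | some halt, h, hq =>
    simp only [nextStmt, Option.some.injEq, Prod.mk.injEq] at h
    rw [← h.1]
    simp [TM2.stmts]

theorem nextStmt_congr (M : Λ → TM2.Stmt (fun _ : K => Γ) Λ σ)
    (q : Option (TM2.Stmt (fun _ : K => Γ) Λ σ)) (v : σ) (x y : Option Γ)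
    (h : (readStack q).isSome → x = y) : nextStmt M q v x = nextStmt M q v y := by
  rcases q with _ | (_ | _ | _ | _ | _ | _ | _) <;> simp_all [nextStmt, readStack]

theorem nextStmt_eq_none_iff (M : Λ → TM2.Stmt (fun _ : K => Γ) Λ σ)
    (q : Option (TM2.Stmt (fun _ : K => Γ) Λ σ)) (v : σ) (x : Option Γ) :
    nextStmt M q v x = none ↔ q = none := by
  rcases q with _ | (_ | _ | _ | _ | _ | _ | _) <;> simp [nextStmt]

/-- The letters of a stack machine with finitely many statements: the statement to be executed, the
internal state and the symbol that is read. -/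
abbrev Letter (M : Λ → TM2.Stmt (fun _ : K => Γ) Λ σ) (S : Finset Λ) : Type :=
  {q // q ∈ TM2.stmts M S} × σ × Option Γ

/-- The stack machine as a system with several stacks. -/
def system [DecidableEq K] (M : Λ → TM2.Stmt (fun _ : K => Γ) Λ σ) (S : Finset Λ) (l₀ : Λ)
    (v₀ : σ) : StackSystem (Letter M S) K Γ where
  start a := a.1.1 = some (M l₀) ∧ a.2.1 = v₀
  next a b := nextStmt M a.1.1 a.2.1 a.2.2 = some (b.1.1, b.2.1)
  halting a := a.1.1 = none
  guard a k o := readStack a.1.1 = some k → o = a.2.2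
  op a k := stmtOp a.1.1 a.2.1 k

theorem exists_not_start [DecidableEq K] (M : Λ → TM2.Stmt (fun _ : K => Γ) Λ σ) (S : Finset Λ)
    (l₀ : Λ) (v₀ : σ) : ∃ a, ¬ (system M S l₀ v₀).start a :=
  ⟨(⟨none, by simp [TM2.stmts]⟩, v₀, none), by simp [system]⟩

theorem accepts_iff [DecidableEq K] [Inhabited Λ] (M : Λ → TM2.Stmt (fun _ : K => Γ) Λ σ)
    (S : Finset Λ) (hS : TM2.Supports M S) (l₀ : Λ) (hl : l₀ ∈ S) (v₀ : σ) (st : K → List Γ) :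
    (system M S l₀ v₀).Accepts st ↔ (eval (TM2.step M) ⟨some l₀, v₀, st⟩).Dom := by
  rw [← smallStep_eval_dom]
  constructor
  · rintro ⟨a, N, ⟨hs, hv⟩, hN, h⟩
    let e : ℕ → SmallCfg K Γ Λ σ := fun i =>
      ((a i).1.1, (a i).2.1, fun k => (system M S l₀ v₀).stackAt a k (st k) i)
    have he0 : e 0 = toSmall M ⟨some l₀, v₀, st⟩ := Prod.ext hs (Prod.ext hv rfl)
    rw [← he0]
    have hr := reaches_of_seq (f := smallStep M) e N (by
      intro i hi
      obtain ⟨-, hn, hg⟩ := h i hi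
      have : nextStmt M (e i).1 (e i).2.1 (readTop (e i)) =
          some ((a (i + 1)).1.1, (a (i + 1)).2.1) := by
        rw [← hn]
        -- If the statement reads no stack, the symbol in the letter is unconstrained but also
        -- irrelevant.
        refine nextStmt_congr M _ _ _ _ fun hsome => ?_
        obtain ⟨k, hk⟩ := Option.isSome_iff_exists.1 hsome
        rw [readTop, hk]
        exact hg k hk
      rw [smallStep, this]
      rfl)
    refine Part.dom_iff_mem.2 ⟨e N, mem_eval.2 ⟨hr, ?_⟩⟩
    rw [smallStep, (nextStmt_eq_none_iff M _ _ _).2 hN]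
    rfl
  · intro hd
    obtain ⟨b, hb⟩ := Part.dom_iff_mem.1 hd
    obtain ⟨hr, hb⟩ := mem_eval.1 hb
    obtain ⟨e, N, h0, rfl, he⟩ := exists_seq_of_reaches hr
    have hstep : ∀ i < N, nextStmt M (e i).1 (e i).2.1 (readTop (e i)) =
        some ((e (i + 1)).1, (e (i + 1)).2.1) ∧
        (e (i + 1)).2.2 = fun k => (stmtOp (e i).1 (e i).2.1 k).apply ((e i).2.2 k) := by
      intro i hi
      have := he i hi
      rw [smallStep, Option.map_eq_some_iff] at this
      obtain ⟨p, hp, hpe⟩ := this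
      rw [← hpe, hp]
      exact ⟨rfl, rfl⟩
    have hmem : ∀ i ≤ N, (e i).1 ∈ TM2.stmts M S := by
      intro i
      induction i with
      | zero =>
        intro _
        rw [h0]
        simp only [toSmall, Option.map_some, TM2.stmts, Finset.some_mem_insertNone,
          Finset.mem_biUnion]
        exact ⟨_, hl, TM2.stmts₁_self⟩
      | succ i ih =>
        intro hi
        exact nextStmt_mem_stmts M S hS (hstep i (by omega)).1 (ih (by omega))
    -- Words are infinite while the computation ends at `N`; its last configuration is repeated.
    let a : ℕ → Letter M S := fun i =>
      (⟨(e (min i N)).1, hmem _ (min_le_right _ _)⟩, (e (min i N)).2.1, readTop (e (min i N)))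
    have hmin : ∀ i ≤ N, min i N = i := fun i hi => min_eq_left hi
    have hst : ∀ k, ∀ i ≤ N, (system M S l₀ v₀).stackAt a k (st k) i = (e i).2.2 k := by
      intro k i
      induction i with
      | zero =>
        intro _
        rw [h0]
        rfl
      | succ i ih =>
        intro hi
        rw [StackSystem.stackAt, ih (by omega), (hstep i (by omega)).2]
        simp only [system, a, hmin i (by omega)]
    refine ⟨a, N, ?_, ?_, ?_⟩
    · simp [system, a, h0, toSmall]
    · rw [smallStep, Option.map_eq_none_iff, nextStmt_eq_none_iff] at hb
      simp [system, a, hb]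
    · intro i hi
      refine ⟨?_, ?_, ?_⟩
      · have := (hstep i hi).1
        intro hhalt
        simp only [system, a, hmin i hi.le] at hhalt
        rw [(nextStmt_eq_none_iff M _ _ _).2 hhalt] at this
        cases this
      · simp only [system, a, hmin i hi.le, hmin (i + 1) hi]
        exact (hstep i hi).1
      · intro k hk
        rw [hst k i hi.le]
        simp only [a, hmin i hi.le] at hk ⊢
        rw [readTop, hk]
        rfl

end StackMachine

/-! ### Computability of the reduction -/

section Computability

open Turing Turing.PartrecToTM2

theorem trNat_of_ne_zero {n : ℕ} (hn : n ≠ 0) :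
    trNat n = cond n.bodd Γ'.bit1 Γ'.bit0 :: trNat n.div2 := by
  obtain ⟨b, m, rfl⟩ : ∃ b m, n = Nat.bit b m := ⟨n.bodd, n.div2, (Nat.bit_bodd_div2 n).symm⟩
  rw [Nat.bodd_bit, Nat.div2_bit, trNat, trNat, ← Num.ofNat'_eq, ← Num.ofNat'_eq, Num.ofNat'_bit]
  rcases hm : Num.ofNat' m with _ | p
  · cases b
    · refine absurd ?_ hn
      have : m = 0 := by
        have := Num.to_of_nat m
        rw [← this, ← Num.ofNat'_eq, hm]
        rfl
      simp [this]
    · rfl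
  · cases b <;> rfl

/-- Binary digits, least significant first, are found by strong recursion through `n.div2`; the
length of the history is `n`. Composing with `g` avoids an encoding of `Γ'`. -/
theorem primrec_map_trNat (g : Γ' → ℕ) : Primrec fun n => (trNat n).map g := by
  have h := Primrec.nat_strong_rec (fun (_ : Unit) n => (trNat n).map g)
    (g := fun _ hist => if hist.length = 0 then some [] else
      (hist[hist.length.div2]?).map fun l =>
        cond hist.length.bodd (g Γ'.bit1) (g Γ'.bit0) :: l)
    (by
      have hlen : Primrec fun p : Unit × List (List ℕ) => p.2.length :=
        Primrec.list_length.comp Primrec.snd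
      refine Primrec.ite (Primrec.eq.comp hlen (Primrec.const 0)) (Primrec.const _) ?_
      refine Primrec.option_map
        (Primrec.list_getElem?.comp Primrec.snd (Primrec.nat_div2.comp hlen)) ?_
      refine Primrec.list_cons.comp (Primrec.cond ?_ (Primrec.const _) (Primrec.const _))
        Primrec.snd
      exact Primrec.nat_bodd.comp (hlen.comp Primrec.fst))
    (by
      intro _ n
      by_cases hn : n = 0
      · simp [hn]
      · have : n.div2 < n := by
          rw [Nat.div2_val]
          omega
        simp only [List.length_map, List.length_range, hn, if_false]
        rw [List.getElem?_map, List.getElem?_range this, trNat_of_ne_zero hn]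
        cases n.bodd <;> rfl)
  exact h.comp (Primrec.const ()) Primrec.id

theorem primrec_loadTrans (F : ℕ) : Primrec (loadTrans F) := by
  have hlen : Primrec fun p : List ℕ × ℕ × List ℕ × List (Trans ℕ ℕ) => p.2.2.1.length :=
    Primrec.list_length.comp (Primrec.fst.comp (Primrec.snd.comp Primrec.snd))
  have h := Primrec.list_rec (f := fun l : List ℕ => l)
    (g := fun _ => ([] : List (Trans ℕ ℕ)))
    (h := fun _ p => Sum.inr (Sum.inl (F + (p.2.1.length + 1), F + p.2.1.length, p.1)) :: p.2.2)
    Primrec.id (Primrec.const _) (by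
      refine Primrec.list_cons.comp (Primrec.sumInr.comp (Primrec.sumInl.comp
        (Primrec.pair ?_ (Primrec.pair ?_ (Primrec.fst.comp Primrec.snd)))))
        (Primrec.snd.comp (Primrec.snd.comp Primrec.snd))
      · exact Primrec.nat_add.comp (Primrec.const F) (Primrec.succ.comp hlen)
      · exact Primrec.nat_add.comp (Primrec.const F) hlen)
  refine h.of_eq fun l => ?_
  induction l with
  | nil => rfl
  | cons x l ih => simp only [loadTrans, ← ih]

/-- All data of `Q` enter as constants, so they need only exist, not be computed. -/
theorem primrec_loadCode {AP S Θ : Type} [Finite AP] [Finite S] [Finite Θ] {k F G : ℕ}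
    (Q : PDS AP S Θ) (eA : AP ≃ Fin k) (eS : S ≃ Fin (F + 1)) (eΘ : Θ ≃ Fin G) :
    Primrec (loadCode Q eA eS eΘ) := by
  have h : Primrec Code.equiv.symm := Primrec.of_equiv_symm
  refine h.comp (g := fun l => Code.equiv (loadCode Q eA eS eΘ l)) ?_
  refine Primrec.pair (Primrec.nat_add.comp (Primrec.const _) Primrec.list_length)
    (Primrec.pair (Primrec.const _) (Primrec.pair ?_ (Primrec.pair ?_ (Primrec.const _))))
  · exact Primrec.list_cons.comp (Primrec.nat_add.comp (Primrec.const F) Primrec.list_length)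
      (Primrec.const [])
  · exact Primrec.list_append.comp (Primrec.const _) (primrec_loadTrans F)

theorem primrec_input (g : Option Γ' → ℕ) :
    Primrec fun n : ℕ => (((trList [n]).map some ++ [none]).reverse).map g := by
  have h : Primrec fun n : ℕ =>
      g none :: g (some Γ'.cons) :: ((trNat n).map fun x => g (some x)).reverse :=
    Primrec.list_cons.comp (Primrec.const _) (Primrec.list_cons.comp (Primrec.const _)
      (Primrec.list_reverse.comp (primrec_map_trNat _)))
  exact h.of_eq fun n => by simp [trList, Function.comp_def]

/-- There is a stack machine in Mathlib's model whose halting problem is undecidable. -/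
theorem exists_code_halting : ∃ c : ToPartrec.Code,
    ¬ ComputablePred fun p : Nat.Partrec.Code =>
      (StateTransition.eval (TM2.step tr) (init c [Encodable.encode p])).Dom := by
  -- The machine is universal: on input `n` it runs the program with number `n` on `0`.
  have hg : Partrec fun n : ℕ => Nat.Partrec.Code.eval (Denumerable.ofNat Nat.Partrec.Code n) 0 :=
    Nat.Partrec.Code.eval_part.comp (Computable.ofNat _) (Computable.const 0)
  obtain ⟨c, hc⟩ := ToPartrec.Code.exists_code (Nat.Partrec'.part_iff₁.2 hg)
  refine ⟨c, fun h => ComputablePred.halting_problem 0 (h.of_eq fun p => ?_)⟩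
  have := hc (Encodable.encode p ::ᵥ List.Vector.nil)
  rw [List.Vector.head_cons, Denumerable.ofNat_encode] at this
  change c.eval [Encodable.encode p] = _ at this
  rw [tr_eval, this]
  rfl

end Computability

/-! ### Finiteness -/

instance {A K Γ : Type} [Finite A] [Finite K] [Finite Γ] : Finite (StackSystem.Loc A K Γ) := by
  refine Finite.of_surjective
    (α := Option (A ⊕ A ⊕ A ⊕ K × A × Option Γ)) (fun
      | none => .root
      | some (.inl a) => .high a
      | some (.inr (.inl a)) => .free a
      | some (.inr (.inr (.inl a))) => .ctl a
      | some (.inr (.inr (.inr (k, a, o)))) => .stk k a o) ?_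
  rintro (_ | a | a | a | ⟨k, a, o⟩)
  · exact ⟨none, rfl⟩
  · exact ⟨some (.inl a), rfl⟩
  · exact ⟨some (.inr (.inl a)), rfl⟩
  · exact ⟨some (.inr (.inr (.inl a))), rfl⟩
  · exact ⟨some (.inr (.inr (.inr (k, a, o)))), rfl⟩

instance : Finite Turing.PartrecToTM2.K' :=
  Finite.of_injective (β := Option (Option Bool)) (fun
    | .main => none
    | .rev => some none
    | .aux => some (some true)
    | .stack => some (some false)) (by
      intro x y h
      cases x <;> cases y <;> first | rfl | cases h)

theorem exists_equiv_fin_last {S : Type} [Finite S] (s : S) :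
    ∃ (F : ℕ) (e : S ≃ Fin (F + 1)), e s = Fin.last F := by
  obtain ⟨n, ⟨e⟩⟩ := Finite.exists_equiv_fin S
  cases n with
  | zero => exact (e s).elim0
  | succ F => exact ⟨F, e.trans (Equiv.swap (e s) (Fin.last F)), by simp⟩

/-! ### Undecidability -/

/-- The error checkers of a stack machine reduce its halting problem to the failure of generalised
non-interference. -/
theorem exists_undecidable_gni : ∃ (k : ℕ) (L H : Finset (Fin k)), Disjoint L H ∧
    L ∪ H = Finset.univ ∧ ¬ ComputablePred fun c : Code => (c.toPDS k).Models (gni L H) := by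
  classical
  obtain ⟨c, hc⟩ := exists_code_halting
  let l₀ := Turing.PartrecToTM2.trNormal c .halt
  -- `TM2.Supports` refers to the default label, so the start label is made the default; `hS.1` then
  -- says that it is supported.
  let : Inhabited Turing.PartrecToTM2.Λ' := ⟨l₀⟩
  have hS := Turing.PartrecToTM2.tr_supports c .halt
  let M := StackMachine.system (K := Turing.PartrecToTM2.K') (Γ := Turing.PartrecToTM2.Γ')
    Turing.PartrecToTM2.tr (Turing.PartrecToTM2.codeSupp c .halt) l₀ none
  let Q := M.checker .main
  obtain ⟨k, ⟨eA⟩⟩ := Finite.exists_equiv_fin (Option (StackMachine.Letter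
    (K := Turing.PartrecToTM2.K') (Γ := Turing.PartrecToTM2.Γ') Turing.PartrecToTM2.tr
    (Turing.PartrecToTM2.codeSupp c .halt)))
  obtain ⟨G, ⟨eΘ⟩⟩ := Finite.exists_equiv_fin (Option Turing.PartrecToTM2.Γ')
  obtain ⟨F, eS, hroot⟩ := exists_equiv_fin_last (S := StackSystem.Loc (StackMachine.Letter
    (K := Turing.PartrecToTM2.K') (Γ := Turing.PartrecToTM2.Γ') Turing.PartrecToTM2.tr
    (Turing.PartrecToTM2.codeSupp c .halt)) Turing.PartrecToTM2.K' Turing.PartrecToTM2.Γ') .root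
  refine ⟨k, {eA none}ᶜ, {eA none}, disjoint_compl_left, by simp, fun hcomp => hc ?_⟩
  -- The reduction is to non-halting; decidability passes to the complement.
  refine (ComputablePred.not (p := fun p => ¬ (StateTransition.eval
    (Turing.TM2.step Turing.PartrecToTM2.tr) (Turing.PartrecToTM2.init c
      [Encodable.encode p])).Dom) ?_).of_eq fun _ => not_not
  refine ComputablePred.computable_of_manyOneReducible ⟨fun p : Nat.Partrec.Code =>
    loadCode Q eA eS eΘ
      ((((Turing.PartrecToTM2.trList [Encodable.encode p]).map some ++ [none]).reverse).map
        fun θ => (eΘ θ : ℕ)), ?_, ?_⟩ hcomp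
  · exact ((primrec_loadCode Q eA eS eΘ).comp
      ((primrec_input fun θ => (eΘ θ : ℕ)).comp Primrec.encode)).to_comp
  · intro p
    rw [models_loadCode Q eA eS eΘ _ _ .root hroot, List.reverse_reverse]
    have hL : eA ⁻¹' (({eA none}ᶜ : Finset (Fin k)) : Set (Fin k)) = Set.range some := by
      ext x
      cases x <;> simp
    have hH : eA ⁻¹' (({eA none} : Finset (Fin k)) : Set (Fin k)) = {none} := by
      ext x
      simp
    rw [hL, hH]
    refine Iff.trans ?_ (M.gniOn_checker_iff .main _
      (StackMachine.exists_not_start _ _ _ _)).symm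
    refine not_congr (Iff.trans ?_ (StackMachine.accepts_iff _ _ hS _ hS.1 _ _).symm)
    have : (StackSystem.single Turing.PartrecToTM2.K'.main
        (Turing.PartrecToTM2.trList [Encodable.encode p])) =
        Turing.PartrecToTM2.K'.elim (Turing.PartrecToTM2.trList [Encodable.encode p]) [] [] [] := by
      funext k
      cases k <;> simp [StackSystem.single]
    rw [this]
    rfl

end HyperPDS

/-- Checking generalised non-interference is undecidable for pushdown systems: both when the
atomic propositions and the low and high variables are part of the input, and for some fixed finite
set of atomic propositions that is partitioned into low and high variables, so that the formula is
fixed and only the pushdown system is the input. -/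
theorem mainTheorem6 :
    (¬ ComputablePred HyperPDS.HasGNI) ∧
    ∃ (k : ℕ) (L H : Finset (Fin k)), Disjoint L H ∧ L ∪ H = Finset.univ ∧
      ¬ ComputablePred (fun c : HyperPDS.Code => (c.toPDS k).Models (HyperPDS.gni L H)) := by
  refine ⟨fun h => ?_, HyperPDS.exists_undecidable_gni⟩
  obtain ⟨k, L, H, -, -, hLH⟩ := HyperPDS.exists_undecidable_gni
  have hlist : ∀ A : Finset (Fin k), HyperPDS.listSet k (A.toList.map Fin.val) = A := by
    intro A
    ext a
    simp [HyperPDS.listSet, Fin.val_inj]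
  -- The fixed formula is a special case: its sets are attached to the code as constant lists.
  refine hLH (ComputablePred.computable_of_manyOneReducible ⟨fun c =>
    (k, c, L.toList.map Fin.val, H.toList.map Fin.val), ?_, fun c => ?_⟩ h)
  · exact (Computable.const k).pair (Computable.id.pair (Computable.const _))
  · simp only [HyperPDS.HasGNI, hlist]
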